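/- For a real random variable $Y$ let $Q_Y(t)=\sup_{a\in\mathbb{R}}\mathbf{P}\{a\le Y\le a+t\}$. For $\gamma>0$ and $\alpha\in\mathbb{R}^n$ let $$\mathrm{LCD}_\gamma(\alpha)=\inf\Big\{\theta>0:\ \mathrm{dist}(\theta\alpha,\mathbb{Z}^n)\le\min\big\{\gamma,\tfrac1{10}\|\theta\alpha\|\big\}\Big\},$$ where $\|\cdot\|$ and $\mathrm{dist}$ are Euclidean. **Theorem.** Let $C,c,\delta>0$ and $p<1$. There are constants $C',c'>0$, and for every $r\in(0,1)$ a constant $K_r$, depending only on $C,c,\delta,p$ (and $K_r$ also on $r$), with the following property. Let $n\ge 0$ and let $X=(X_1,\dots,X_n)$ have i.i.d. real coordinates with $\mathbf{E}[X_i]=0$, with the sub-Gaussian tail bound $\mathbf{P}\{|X_i|\ge t\}\le Ce^{-ct^2}$ for all $t>0$, and with $Q_{X_i}(\delta)\le p$. (Every non-degenerate distribution satisfies the last condition for some $\delta>0$ and $p<1$.) Then for all $\alpha,\beta\in\mathbb{R}^n$ with $\alpha\ne0$ and all $\gamma>0$, $$\mathbf{P}\{|\langle\alpha,X\rangle|\le|\langle\beta,X\rangle|\}\le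 C'\left\{\frac{\|\beta\|}{\|\alpha\|}\Big(1+\sqrt{\log^+\tfrac{\|\alpha\|}{\|\beta\|}}\Big)+\frac1{\mathrm{LCD}_\gamma(\alpha/\|\alpha\|)}+e^{-c'\gamma^2}\right\},$$ where $\log^+x=\max(\log x,0)$; and for every $r\in(0,1)$, if moreover $\|\beta\|\le r\|\alpha\|$, then $$\mathbf{P}\{|\langle\alpha,X\rangle|\le|\langle\beta,X\rangle|\}\le K_r\left\{\frac{\|\beta\|}{\|\alpha\|}\sqrt{\log\tfrac{\|\alpha\|}{\|\beta\|}}+\frac1{\mathrm{LCD}_\gamma(\alpha/\|\alpha\|)}+e^{-c'\gamma^2}\right\}.$$ If $\beta=0$, the first term on the right is read as its limit $0$ in both bounds. -/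

import Mathlib

open MeasureTheory ProbabilityTheory

/-- The integer lattice `ℤⁿ` as a subset of Euclidean space `ℝⁿ`. -/
def integerLattice (n : ℕ) : Set (EuclideanSpace ℝ (Fin n)) :=
  {z | ∀ i, ∃ k : ℤ, z i = (k : ℝ)}

/-- The essential least common denominator
`LCD_γ(α) = inf {θ > 0 : dist(θα, ℤⁿ) ≤ min (γ, ‖θα‖ / 10)}`.
For `α ≠ 0` and `γ > 0` the set is nonempty (simultaneous Diophantine approximation) and its
infimum is positive, so that `sInf` is the true infimum and `1 / LCD` is a true quotient. -/
noncomputable def essentialLCD {n : ℕ} (γ : ℝ) (α : EuclideanSpace ℝ (Fin n)) : ℝ :=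
  sInf {θ : ℝ | 0 < θ ∧
    Metric.infDist (θ • α) (integerLattice n) ≤ min γ (1 / 10 * ‖θ • α‖)}

/-- The Lévy concentration function `Q_Y(t) = sup_a P(a ≤ Y ≤ a + t)`. -/
noncomputable def levyConcentration {Ω : Type*} [MeasurableSpace Ω] (P : Measure Ω)
    (Y : Ω → ℝ) (t : ℝ) : ℝ :=
  ⨆ a : ℝ, P.real {ω | a ≤ Y ω ∧ Y ω ≤ a + t}

/-- The linear form `⟨α, X⟩ = ∑ αᵢ Xᵢ`. -/
noncomputable def linearForm {Ω : Type*} {n : ℕ} (α : EuclideanSpace ℝ (Fin n))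
    (X : Fin n → Ω → ℝ) (ω : Ω) : ℝ :=
  ∑ i, α i * X i ω

/-! Normalise α to a unit vector and fix a level τ‖β‖. If |⟨α,X⟩| ≤ |⟨β,X⟩|, then either |⟨β,X⟩| ≥
τ‖β‖ or |⟨α,X⟩| ≤ τ‖β‖. The first event is rare by Hoeffding's inequality. With τ of order
√log(‖α‖/‖β‖) its probability is at most 2‖β‖/‖α‖, and the second event becomes a small ball event
of radius (‖β‖/‖α‖)√log(‖α‖/‖β‖), up to a constant.

The small ball estimate (`measureReal_abs_linearForm_le`) is Fourier-analytic. Esseen's inequality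
bounds the probability by an average of the characteristic function. Symmetrising the coordinates
bounds that function by an exponential in E Σ(1 − cos(s αᵢ z)), where z is the difference of two
independent copies of a coordinate. The concentration hypothesis gives |z| ≥ δ/2 with probability at
least 1 − p; conditioning on this and applying Jensen reduces everything, for each fixed z, to the
integral over an interval of exp(−b dist(θα, ℤⁿ)²).

That integral is where the LCD enters (`integral_exp_infDist_short_le`). On an interval shorter than
the LCD let m minimise the distance f(θ) = dist(θα, ℤⁿ). Since θ − m is below the LCD, 2f(θ) ≥ f(θ)
+ f(m) ≥ min(γ, |θ − m|/10): the integrand is below e^{−bγ²/4} plus a Gaussian centred at m. An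
interval of length L is covered by at most L/LCD + 1 such pieces, and dividing by L yields the terms
1/LCD, 1/L (proportional to the radius) and e^{−c'γ²}. -/

/-! ### Distance to the integer lattice and the essential LCD. -/

theorem zero_mem_integerLattice (n : ℕ) : (0 : EuclideanSpace ℝ (Fin n)) ∈ integerLattice n :=
  fun _ => ⟨0, by simp⟩

theorem sub_mem_integerLattice {n : ℕ} {x y : EuclideanSpace ℝ (Fin n)}
    (hx : x ∈ integerLattice n) (hy : y ∈ integerLattice n) : x - y ∈ integerLattice n := by
  intro i
  obtain ⟨k, hk⟩ := hx i
  obtain ⟨l, hl⟩ := hy i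
  exact ⟨k - l, by simp [hk, hl]⟩

theorem infDist_integerLattice_sub_le {n : ℕ} (x y : EuclideanSpace ℝ (Fin n)) :
    Metric.infDist (x - y) (integerLattice n) ≤
      Metric.infDist x (integerLattice n) + Metric.infDist y (integerLattice n) := by
  have hne : (integerLattice n).Nonempty := ⟨0, zero_mem_integerLattice n⟩
  refine le_of_forall_pos_le_add fun ε hε => ?_
  obtain ⟨u, hu, hxu⟩ := (Metric.infDist_lt_iff hne).1
    (lt_add_of_pos_right (Metric.infDist x (integerLattice n)) (half_pos hε))
  obtain ⟨v, hv, hyv⟩ := (Metric.infDist_lt_iff hne).1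
    (lt_add_of_pos_right (Metric.infDist y (integerLattice n)) (half_pos hε))
  have h1 := Metric.infDist_le_dist_of_mem (x := x - y) (sub_mem_integerLattice hu hv)
  have h2 := dist_sub_sub_le x y u v
  linarith

/-- Rounding every coordinate bounds the distance to the lattice. -/
theorem infDist_integerLattice_sq_le {n : ℕ} (x : EuclideanSpace ℝ (Fin n)) :
    Metric.infDist x (integerLattice n) ^ 2 ≤ ∑ i, (x i - round (x i)) ^ 2 := by
  set z : EuclideanSpace ℝ (Fin n) := WithLp.toLp 2 fun i => (round (x i) : ℝ) with hz
  have hmem : z ∈ integerLattice n := fun i => ⟨round (x i), by simp [hz]⟩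
  calc Metric.infDist x (integerLattice n) ^ 2 ≤ dist x z ^ 2 := by
        gcongr
        · exact Metric.infDist_nonneg
        · exact Metric.infDist_le_dist_of_mem hmem
    _ = ∑ i, (x i - round (x i)) ^ 2 := by
        rw [dist_eq_norm, EuclideanSpace.norm_sq_eq]
        simp [hz]

/-- Every coordinate is at most 1/2 in absolute value, so 0 is a nearest integer to each and the
origin is a nearest lattice point. -/
theorem le_infDist_integerLattice {n : ℕ} {x : EuclideanSpace ℝ (Fin n)} (hx : ‖x‖ ≤ 1 / 2) :
    ‖x‖ ≤ Metric.infDist x (integerLattice n) := by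
  have hne : (integerLattice n).Nonempty := ⟨0, zero_mem_integerLattice n⟩
  refine (Metric.le_infDist hne).2 fun z hz => ?_
  rw [dist_eq_norm]
  refine le_of_sq_le_sq ?_ (norm_nonneg _)
  rw [EuclideanSpace.norm_sq_eq, EuclideanSpace.norm_sq_eq]
  refine Finset.sum_le_sum fun i _ => ?_
  obtain ⟨k, hk⟩ := hz i
  have hi : |x i| ≤ 1 / 2 := (PiLp.norm_apply_le x i).trans hx
  simp only [PiLp.sub_apply, hk, Real.norm_eq_abs, sq_abs]
  obtain ⟨h1, h2⟩ := abs_le.1 hi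
  rcases lt_trichotomy k 0 with h | h | h
  · have : (k : ℝ) ≤ -1 := by exact_mod_cast (by omega : k ≤ -1)
    nlinarith
  · simp [h]
  · have : (1 : ℝ) ≤ k := by exact_mod_cast h
    nlinarith

/-- Simultaneous Diophantine approximation. -/
theorem exists_one_le_infDist_integerLattice_le {n : ℕ} (α : EuclideanSpace ℝ (Fin n)) {ε : ℝ}
    (hε : 0 < ε) : ∃ θ : ℝ, 1 ≤ θ ∧ Metric.infDist (θ • α) (integerLattice n) ≤ ε := by
  set u : ℕ → EuclideanSpace ℝ (Fin n) :=
    fun k => WithLp.toLp 2 fun i => Int.fract ((k : ℝ) * α i) with hu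
  have hb : ∀ k, u k ∈ Metric.closedBall (0 : EuclideanSpace ℝ (Fin n)) (Real.sqrt n) := by
    intro k
    rw [mem_closedBall_zero_iff, EuclideanSpace.norm_eq]
    refine Real.sqrt_le_sqrt ?_
    calc ∑ i, ‖u k i‖ ^ 2 ≤ ∑ _i : Fin n, (1 : ℝ) := by
          refine Finset.sum_le_sum fun i _ => ?_
          simp only [hu, Real.norm_eq_abs, sq_abs]
          have h0 := Int.fract_nonneg ((k : ℝ) * α i)
          have h1 := Int.fract_lt_one ((k : ℝ) * α i)
          nlinarith
      _ = n := by simp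
  -- Compactness replaces the pigeonhole principle: two integer multiples of α have fractional parts
  -- within ε of each other, and the difference of their distinct indices is the desired θ ≥ 1.
  obtain ⟨a, -, φ, hφ, hlim⟩ := tendsto_subseq_of_bounded Metric.isBounded_closedBall hb
  obtain ⟨N, hN⟩ := Metric.cauchySeq_iff.1 hlim.cauchySeq ε hε
  have hlt : φ N < φ (N + 1) := hφ (Nat.lt_succ_self N)
  refine ⟨(φ (N + 1) : ℝ) - φ N, ?_, ?_⟩
  · have : ((φ N + 1 : ℕ) : ℝ) ≤ φ (N + 1) := by exact_mod_cast hlt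
    push_cast at this
    linarith
  · set z : EuclideanSpace ℝ (Fin n) := WithLp.toLp 2 fun i =>
      ((⌊(φ (N + 1) : ℝ) * α i⌋ - ⌊(φ N : ℝ) * α i⌋ : ℤ) : ℝ) with hz
    have hmem : z ∈ integerLattice n := fun i => ⟨_, rfl⟩
    refine (Metric.infDist_le_dist_of_mem hmem).trans ?_
    have hd := (hN (N + 1) (Nat.le_succ N) N le_rfl).le
    rw [dist_eq_norm] at hd ⊢
    convert hd using 2
    ext i
    simp only [hz, hu, Int.fract, Function.comp, PiLp.sub_apply, PiLp.smul_apply, smul_eq_mul]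
    push_cast
    ring

/-- The LCD of a unit vector is at least 1/2: for smaller θ the distance of θα to the lattice is θ
itself, which exceeds θ/10. Diophantine approximation makes the set nonempty, so `sInf` is not the
default value 0. -/
theorem essentialLCD_pos {n : ℕ} {α : EuclideanSpace ℝ (Fin n)} (hα : ‖α‖ = 1) {γ : ℝ}
    (hγ : 0 < γ) : 0 < essentialLCD γ α := by
  refine lt_of_lt_of_le (by norm_num : (0 : ℝ) < 1 / 2) (le_csInf ?_ ?_)
  · obtain ⟨θ, h1, h2⟩ := exists_one_le_infDist_integerLattice_le α
      (lt_min hγ (by norm_num : (0 : ℝ) < 1 / 10))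
    refine ⟨θ, by linarith, h2.trans (min_le_min le_rfl ?_)⟩
    rw [norm_smul, hα, Real.norm_eq_abs]
    linarith [le_abs_self θ]
  · rintro θ ⟨h0, h⟩
    by_contra! hlt
    have hn : ‖θ • α‖ = θ := by rw [norm_smul, hα, Real.norm_eq_abs, abs_of_pos h0, mul_one]
    have := (le_infDist_integerLattice (x := θ • α) (by rw [hn]; exact hlt.le)).trans
      (h.trans (min_le_right _ _))
    rw [hn] at this
    linarith

theorem min_le_infDist_of_lt_essentialLCD {n : ℕ} {α : EuclideanSpace ℝ (Fin n)} (hα : ‖α‖ = 1)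
    {γ : ℝ} (hγ : 0 < γ) {θ : ℝ} (h0 : 0 ≤ θ) (hθ : θ < essentialLCD γ α) :
    min γ (θ / 10) ≤ Metric.infDist (θ • α) (integerLattice n) := by
  rcases h0.eq_or_lt with rfl | h0
  · simp [hγ.le, Metric.infDist_nonneg]
  · by_contra! hlt
    refine notMem_of_lt_csInf hθ ⟨0, fun x hx => hx.1.le⟩ ⟨h0, hlt.le.trans ?_⟩
    rw [norm_smul, hα, Real.norm_eq_abs, abs_of_pos h0]
    exact min_le_min le_rfl (by linarith)

/-- The lattice is a group, so if xα and yα were both close to it, then (x − y)α would be too, which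
is impossible for |x − y| below the LCD. -/
theorem min_abs_sub_le_infDist_add {n : ℕ} {α : EuclideanSpace ℝ (Fin n)} (hα : ‖α‖ = 1)
    {γ : ℝ} (hγ : 0 < γ) {x y : ℝ} (h : |x - y| < essentialLCD γ α) :
    min γ (|x - y| / 10) ≤ Metric.infDist (x • α) (integerLattice n) +
      Metric.infDist (y • α) (integerLattice n) := by
  refine (min_le_infDist_of_lt_essentialLCD hα hγ (abs_nonneg _) h).trans ?_
  rcases le_total y x with hxy | hxy
  · rw [abs_of_nonneg (sub_nonneg.2 hxy), sub_smul]
    exact infDist_integerLattice_sub_le _ _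
  · rw [abs_sub_comm, abs_of_nonneg (sub_nonneg.2 hxy), sub_smul, add_comm]
    exact infDist_integerLattice_sub_le _ _

/-! ### Integrals of exp(−b dist(θα, ℤⁿ)²). -/

theorem continuous_infDist_smul {n : ℕ} (α : EuclideanSpace ℝ (Fin n)) :
    Continuous fun θ : ℝ => Metric.infDist (θ • α) (integerLattice n) :=
  (Metric.continuous_infDist_pt _).comp (continuous_id.smul continuous_const)

/-- On an interval shorter than the LCD the integral is at most a Gaussian integral plus a
remainder. -/
theorem integral_exp_infDist_short_le {n : ℕ} {α : EuclideanSpace ℝ (Fin n)} (hα : ‖α‖ = 1)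
    {γ b x y : ℝ} (hγ : 0 < γ) (hb : 0 < b) (hxy : x ≤ y) (h : y - x < essentialLCD γ α) :
    ∫ θ in x..y, Real.exp (-b * Metric.infDist (θ • α) (integerLattice n) ^ 2) ≤
      (y - x) * Real.exp (-(b / 4) * γ ^ 2) + Real.sqrt (Real.pi / (b / 400)) := by
  set f : ℝ → ℝ := fun θ => Metric.infDist (θ • α) (integerLattice n) with hf
  have hfc : Continuous f := continuous_infDist_smul α
  obtain ⟨m, hm, hmin⟩ := isCompact_Icc.exists_isMinOn (Set.nonempty_Icc.2 hxy) hfc.continuousOn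
  have hg : Integrable fun θ : ℝ => Real.exp (-(b / 400) * (θ - m) ^ 2) :=
    (integrable_exp_neg_mul_sq (by positivity : 0 < b / 400)).comp_sub_right m
  have hpt : ∀ θ ∈ Set.Icc x y, Real.exp (-b * f θ ^ 2) ≤
      Real.exp (-(b / 4) * γ ^ 2) + Real.exp (-(b / 400) * (θ - m) ^ 2) := by
    intro θ hθ
    have hle : f m ≤ f θ := hmin hθ
    have habs : |θ - m| < essentialLCD γ α := by
      refine lt_of_le_of_lt (abs_le.2 ⟨?_, ?_⟩) h <;> linarith [hθ.1, hθ.2, hm.1, hm.2]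
    have key : min γ (|θ - m| / 10) ≤ f θ + f m := min_abs_sub_le_infDist_add hα hγ habs
    -- Either f θ ≥ γ/2 or f θ ≥ |θ − m|/20; squaring gives the constants b/4 and b/400.
    rcases min_le_iff.1 (key.trans (by linarith : f θ + f m ≤ 2 * f θ)) with h1 | h1
    · refine le_add_of_le_of_nonneg (Real.exp_le_exp.2 ?_) (Real.exp_pos _).le
      nlinarith [mul_le_mul_of_nonneg_left (pow_le_pow_left₀ hγ.le h1 2) hb.le]
    · refine le_add_of_nonneg_of_le (Real.exp_pos _).le (Real.exp_le_exp.2 ?_)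
      have := mul_le_mul_of_nonneg_left
        (pow_le_pow_left₀ (by positivity : 0 ≤ |θ - m| / 10) h1 2) hb.le
      rw [div_pow, sq_abs] at this
      nlinarith
  calc ∫ θ in x..y, Real.exp (-b * f θ ^ 2)
      ≤ ∫ θ in x..y, (Real.exp (-(b / 4) * γ ^ 2) + Real.exp (-(b / 400) * (θ - m) ^ 2)) := by
        refine intervalIntegral.integral_mono_on hxy ?_ ?_ hpt
        · exact Continuous.intervalIntegrable (by fun_prop) _ _
        · exact Continuous.intervalIntegrable (by fun_prop) _ _
    _ = (y - x) * Real.exp (-(b / 4) * γ ^ 2) +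
          ∫ θ in x..y, Real.exp (-(b / 400) * (θ - m) ^ 2) := by
        rw [intervalIntegral.integral_add (by simp) hg.intervalIntegrable]
        simp
    _ ≤ _ := by
        gcongr
        rw [intervalIntegral.integral_of_le hxy, ← integral_gaussian (b / 400),
          ← integral_sub_right_eq_self (fun θ : ℝ => Real.exp (-(b / 400) * θ ^ 2)) m]
        exact setIntegral_le_integral hg (Filter.Eventually.of_forall fun _ => (Real.exp_pos _).le)

theorem integral_exp_infDist_le {n : ℕ} {α : EuclideanSpace ℝ (Fin n)} (hα : ‖α‖ = 1)
    {γ b L : ℝ} (hγ : 0 < γ) (hb : 0 < b) (hL : 0 < L) :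
    ∫ u in (0 : ℝ)..1, Real.exp (-b * Metric.infDist ((L * u) • α) (integerLattice n) ^ 2) ≤
      Real.exp (-(b / 4) * γ ^ 2) +
        Real.sqrt (Real.pi / (b / 400)) * (1 / L + 1 / essentialLCD γ α) := by
  set F : ℝ → ℝ := fun θ => Real.exp (-b * Metric.infDist (θ • α) (integerLattice n) ^ 2) with hF
  have hFc : Continuous F := by
    have := continuous_infDist_smul α
    fun_prop
  set D := essentialLCD γ α with hD
  have hDpos : 0 < D := essentialLCD_pos hα hγ
  -- The extra 1 makes the N equal pieces of [0, L] strictly shorter than the LCD.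
  set N : ℕ := ⌊L / D⌋₊ + 1 with hN
  have hN0 : (0 : ℝ) < N := by positivity
  have hN1 : L / D < N := by simpa [hN] using Nat.lt_floor_add_one (L / D)
  have hN2 : (N : ℝ) ≤ L / D + 1 := by
    simpa [hN] using Nat.floor_le (by positivity : 0 ≤ L / D)
  have hshort : L / N < D := by
    rw [div_lt_iff₀ hDpos] at hN1
    rw [div_lt_iff₀ hN0]
    linarith
  have hsplit := intervalIntegral.sum_integral_adjacent_intervals (μ := volume) (f := F)
    (a := fun k : ℕ => (k : ℝ) * (L / N)) (n := N) fun k _ => hFc.intervalIntegrable _ _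
  have hbound : ∫ θ in (0 : ℝ)..L, F θ ≤
      L * Real.exp (-(b / 4) * γ ^ 2) + N * Real.sqrt (Real.pi / (b / 400)) := by
    have hend : (N : ℝ) * (L / N) = L := by field_simp
    rw [Nat.cast_zero, zero_mul, hend] at hsplit
    rw [← hsplit]
    refine (Finset.sum_le_sum (g := fun _ : ℕ => L / N * Real.exp (-(b / 4) * γ ^ 2) +
      Real.sqrt (Real.pi / (b / 400))) fun k _ => ?_).trans_eq ?_
    · have hlen : ((k + 1 : ℕ) : ℝ) * (L / N) - k * (L / N) = L / N := by push_cast; ring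
      have := integral_exp_infDist_short_le hα (x := k * (L / N)) (y := ((k + 1 : ℕ) : ℝ) * (L / N))
        hγ hb (by have : 0 < L / N := by positivity
                  linarith) (by rw [hlen]; exact hshort)
      rwa [hlen] at this
    · rw [Finset.sum_const, Finset.card_range, nsmul_eq_mul, mul_add, ← mul_assoc, hend]
  have hsub : ∫ u in (0 : ℝ)..1, F (L * u) = L⁻¹ * ∫ θ in (0 : ℝ)..L, F θ := by
    rw [intervalIntegral.integral_comp_mul_left F hL.ne']
    simp
  change ∫ u in (0 : ℝ)..1, F (L * u) ≤ _
  rw [hsub]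
  calc L⁻¹ * ∫ θ in (0 : ℝ)..L, F θ
      ≤ L⁻¹ * (L * Real.exp (-(b / 4) * γ ^ 2) +
          (L / D + 1) * Real.sqrt (Real.pi / (b / 400))) := by
        gcongr
        exact hbound.trans (by gcongr)
    _ = _ := by
        field_simp
        ring

/-! ### The Fejér kernel and Esseen's inequality. -/

/-- The closed form shows that the kernel is nonnegative. Being also at least 1/2 on [−1, 1], its
double dominates the indicator of that interval, while its Fourier side has compact support. -/
theorem integral_fejer_eq {x : ℝ} (hx : x ≠ 0) :
    ∫ u in (0 : ℝ)..1, 2 * (1 - u) * Real.cos (u * x) = 2 * (1 - Real.cos x) / x ^ 2 := by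
  have hderiv : ∀ u ∈ Set.uIcc (0 : ℝ) 1, HasDerivAt
      (fun u : ℝ => 2 * (1 - u) * Real.sin (u * x) / x - 2 * Real.cos (u * x) / x ^ 2)
      (2 * (1 - u) * Real.cos (u * x)) u := by
    intro u _
    have h1 : HasDerivAt (fun u : ℝ => u * x) x u := by simpa using (hasDerivAt_id u).mul_const x
    have h2 : HasDerivAt (fun u : ℝ => 2 * (1 - u)) (-2) u := by
      simpa using ((hasDerivAt_id u).const_sub 1).const_mul 2
    refine (((h2.mul h1.sin).div_const x).sub
      ((h1.cos.const_mul 2).div_const (x ^ 2))).congr_deriv ?_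
    have h3 : 2 * (1 - u) * (Real.cos (u * x) * x) / x = 2 * (1 - u) * Real.cos (u * x) :=
      by field_simp
    have h4 : 2 * (-Real.sin (u * x) * x) / x ^ 2 = -2 * Real.sin (u * x) / x := by field_simp
    rw [add_div, h3, h4]
    ring
  rw [intervalIntegral.integral_eq_sub_of_hasDerivAt hderiv
    (Continuous.intervalIntegrable (by fun_prop) _ _)]
  simp
  ring

theorem integral_fejer_nonneg (x : ℝ) :
    0 ≤ ∫ u in (0 : ℝ)..1, 2 * (1 - u) * Real.cos (u * x) := by
  rcases eq_or_ne x 0 with rfl | hx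
  · refine intervalIntegral.integral_nonneg zero_le_one fun u hu => ?_
    simp [hu.2]
  · rw [integral_fejer_eq hx]
    have := Real.cos_le_one x
    have : 0 ≤ 1 - Real.cos x := by linarith
    positivity

theorem half_le_integral_fejer {x : ℝ} (hx : |x| ≤ 1) :
    1 / 2 ≤ ∫ u in (0 : ℝ)..1, 2 * (1 - u) * Real.cos (u * x) := by
  have h : ∫ u in (0 : ℝ)..1, (1 - u) = 1 / 2 := by
    rw [intervalIntegral.integral_sub (by simp) (by simp)]
    simp
    norm_num
  rw [← h]
  refine intervalIntegral.integral_mono_on zero_le_one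
    (Continuous.intervalIntegrable (by fun_prop) _ _)
    (Continuous.intervalIntegrable (by fun_prop) _ _) fun u hu => ?_
  have h1 : |u * x| ≤ 1 := by
    rw [abs_mul, abs_of_nonneg hu.1]
    exact mul_le_one₀ hu.2 (abs_nonneg _) hx
  have h2 : (u * x) ^ 2 ≤ 1 := (sq_le_one_iff_abs_le_one _).2 h1
  have h3 := Real.one_sub_sq_div_two_le_cos (x := u * x)
  nlinarith [hu.2]

theorem re_charFun_eq_integral_cos (μ : Measure ℝ) [IsFiniteMeasure μ] (s : ℝ) :
    (charFun μ s).re = ∫ x, Real.cos (s * x) ∂μ := by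
  have hint : Integrable (fun x : ℝ => Complex.exp ((s * x : ℝ) * Complex.I)) μ := by
    refine Integrable.of_bound (by fun_prop) 1 (Filter.Eventually.of_forall fun x => ?_)
    rw [Complex.norm_exp_ofReal_mul_I]
  have := integral_re hint
  rw [charFun_apply_real]
  simp only [Complex.ofReal_mul] at this
  rw [← RCLike.re_eq_complex_re, ← this]
  refine integral_congr_ae (Filter.Eventually.of_forall fun x => ?_)
  have := Complex.exp_ofReal_mul_I_re (s * x)
  simpa using this

/-- Esseen inequality at the origin. -/
theorem measureReal_abs_le_le_integral_norm_charFun (μ : Measure ℝ) [IsProbabilityMeasure μ]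
    {t : ℝ} (ht : 0 < t) :
    μ.real {x | |x| ≤ t} ≤ 4 * ∫ u in (0 : ℝ)..1, ‖charFun μ (u / t)‖ := by
  set k : ℝ → ℝ := fun x => ∫ u in (0 : ℝ)..1, 2 * (1 - u) * Real.cos (u * x) with hk
  have hint : Integrable (Function.uncurry fun (x u : ℝ) => 2 * (1 - u) * Real.cos (u * (x / t)))
      (μ.prod (volume.restrict (Set.Ioc 0 1))) := by
    have h1 : Integrable (fun u : ℝ => 2 * (1 - u)) (volume.restrict (Set.Ioc 0 1)) :=
      (Continuous.integrableOn_Ioc (by fun_prop))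
    have h2 := (integrable_const (1 : ℝ) (μ := μ)).mul_prod h1
    refine (h2.mul_bdd (c := 1) (g := fun z : ℝ × ℝ => Real.cos (z.2 * (z.1 / t)))
      (by fun_prop) (Filter.Eventually.of_forall fun z => ?_)).congr
      (Filter.Eventually.of_forall fun z => ?_)
    · exact Real.abs_cos_le_one _
    · simp [Function.uncurry]
  have hkint : Integrable (fun x => k (x / t)) μ := by
    refine hint.integral_prod_left.congr (Filter.Eventually.of_forall fun x => ?_)
    simp [hk, intervalIntegral.integral_of_le zero_le_one]
  have hmeas : MeasurableSet {x : ℝ | |x| ≤ t} := (isClosed_le continuous_abs continuous_const).measurableSet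
  have hle : μ.real {x | |x| ≤ t} ≤ ∫ x, 2 * k (x / t) ∂μ := by
    rw [← integral_indicator_one hmeas]
    refine integral_mono ((integrable_const 1).indicator hmeas) (hkint.const_mul 2) fun x => ?_
    by_cases hx : x ∈ {x : ℝ | |x| ≤ t}
    · rw [Set.indicator_of_mem hx]
      have : 1 / 2 ≤ k (x / t) := half_le_integral_fejer (by
        rw [abs_div, abs_of_pos ht]
        exact div_le_one_of_le₀ hx ht.le)
      simp only [Pi.one_apply]
      linarith
    · rw [Set.indicator_of_notMem hx]
      have : 0 ≤ k (x / t) := integral_fejer_nonneg _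
      positivity
  have hswap : ∫ x, k (x / t) ∂μ = ∫ u in (0 : ℝ)..1, 2 * (1 - u) * (charFun μ (u / t)).re := by
    simp only [hk, intervalIntegral.integral_of_le zero_le_one]
    rw [integral_integral_swap hint]
    refine integral_congr_ae (Filter.Eventually.of_forall fun u => ?_)
    simp only
    rw [integral_const_mul, re_charFun_eq_integral_cos]
    congr 1
    refine integral_congr_ae (Filter.Eventually.of_forall fun x => ?_)
    simp only
    congr 1
    ring
  have hcm : Measurable (charFun μ) := measurable_charFun
  rw [integral_const_mul, hswap] at hle
  refine hle.trans ?_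
  -- One factor 2 comes from the kernel being at least 1/2 on the ball, the other from the weight
  -- 2(1 − u) ≤ 2.
  rw [show (4 : ℝ) = 2 * 2 by norm_num, mul_assoc]
  refine mul_le_mul_of_nonneg_left ?_ (zero_le_two (α := ℝ))
  rw [← intervalIntegral.integral_const_mul]
  have hb : ∀ u : ℝ, ‖charFun μ (u / t)‖ ≤ 1 := fun u => norm_charFun_le_one _
  have hI1 : IntervalIntegrable (fun u => ‖charFun μ (u / t)‖) volume 0 1 := by
    rw [intervalIntegrable_iff, Set.uIoc_of_le zero_le_one]
    refine Integrable.of_bound (by fun_prop) 1 (Filter.Eventually.of_forall fun u => ?_)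
    simpa using hb u
  have hI2 : IntervalIntegrable (fun u => (charFun μ (u / t)).re) volume 0 1 := by
    rw [intervalIntegrable_iff, Set.uIoc_of_le zero_le_one]
    refine Integrable.of_bound (Complex.measurable_re.comp (by fun_prop)).aestronglyMeasurable 1
      (Filter.Eventually.of_forall fun u => ?_)
    exact (Complex.abs_re_le_norm _).trans (hb u)
  refine intervalIntegral.integral_mono_on zero_le_one
    (hI2.continuousOn_mul (g := fun u => 2 * (1 - u)) (by fun_prop)) (hI1.const_mul 2) fun u hu => ?_
  have h1 := Complex.re_le_norm (charFun μ (u / t))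
  have h2 := norm_nonneg (charFun μ (u / t))
  nlinarith [hu.1, hu.2, mul_le_mul_of_nonneg_left h1 (sub_nonneg.2 hu.2), mul_nonneg hu.1 h2]

/-! ### Symmetrization and bounds for one coordinate. -/

/-- The law of the difference of two independent variables with law `μ`. -/
noncomputable def symmetrization (μ : Measure ℝ) : Measure ℝ :=
  (μ.prod (μ.map fun x => -1 * x)).map fun z => z.1 + z.2

instance isProbabilityMeasure_symmetrization (μ : Measure ℝ) [IsProbabilityMeasure μ] :
    IsProbabilityMeasure (symmetrization μ) := by
  have : IsProbabilityMeasure (μ.map fun x => -1 * x) :=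
    Measure.isProbabilityMeasure_map (by fun_prop)
  exact Measure.isProbabilityMeasure_map (by fun_prop)

theorem norm_charFun_sq_eq (μ : Measure ℝ) [IsProbabilityMeasure μ] (s : ℝ) :
    ‖charFun μ s‖ ^ 2 = ∫ z, Real.cos (s * z) ∂symmetrization μ := by
  have : IsProbabilityMeasure (μ.map fun x => -1 * x) :=
    Measure.isProbabilityMeasure_map (by fun_prop)
  rw [← re_charFun_eq_integral_cos, symmetrization, charFun_map_add_prod_eq_mul, Pi.mul_apply,
    charFun_map_mul, neg_one_mul, charFun_neg, Complex.mul_conj, Complex.normSq_eq_norm_sq,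
    Complex.ofReal_re]

/-- The squared modulus is the symmetrized cosine average, and x² = 1 − (1 − x²) ≤ exp(−(1 − x²)).
-/
theorem norm_charFun_le_exp (μ : Measure ℝ) [IsProbabilityMeasure μ] (s : ℝ) :
    ‖charFun μ s‖ ≤ Real.exp (-(∫ z, (1 - Real.cos (s * z)) ∂symmetrization μ) / 2) := by
  have hcos : Integrable (fun z => Real.cos (s * z)) (symmetrization μ) :=
    Integrable.of_bound (by fun_prop) 1
      (Filter.Eventually.of_forall fun z => Real.abs_cos_le_one _)
  rw [integral_sub (integrable_const _) hcos, ← norm_charFun_sq_eq]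
  refine le_of_sq_le_sq ?_ (Real.exp_pos _).le
  rw [← Real.exp_nat_mul]
  refine le_trans ?_ (Real.add_one_le_exp _)
  simp
  linarith

/-- By periodicity y may be replaced by w = y − round y; then 1 − cos 2πw = 2 sin² πw, and |sin πw|
≥ 2|w| for |w| ≤ 1/2 by concavity. -/
theorem eight_mul_sub_round_sq_le (y : ℝ) :
    8 * (y - round y) ^ 2 ≤ 1 - Real.cos (2 * Real.pi * y) := by
  set w := y - round y with hw
  have h1 : Real.cos (2 * Real.pi * y) = Real.cos (2 * (Real.pi * w)) := by
    rw [← Real.cos_sub_int_mul_two_pi (2 * Real.pi * y) (round y)]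
    congr 1
    rw [hw]
    ring
  have h2 : |Real.pi * w| ≤ Real.pi / 2 := by
    rw [abs_mul, abs_of_pos Real.pi_pos]
    nlinarith [abs_sub_round y, Real.pi_pos]
  have h3 := Real.mul_abs_le_abs_sin h2
  rw [abs_mul, abs_of_pos Real.pi_pos, ← mul_assoc, div_mul_cancel₀ _ Real.pi_ne_zero] at h3
  have h4 := pow_le_pow_left₀ (by positivity) h3 2
  rw [mul_pow, sq_abs, sq_abs] at h4
  rw [h1, Real.cos_two_mul']
  nlinarith [Real.sin_sq_add_cos_sq (Real.pi * w)]

theorem infDist_sq_le_sum_one_sub_cos {n : ℕ} (α : EuclideanSpace ℝ (Fin n)) (s z : ℝ) :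
    8 * Metric.infDist ((s * |z| / (2 * Real.pi)) • α) (integerLattice n) ^ 2 ≤
      ∑ i, (1 - Real.cos (s * α i * z)) := by
  calc _ ≤ 8 * ∑ i, ((((s * |z| / (2 * Real.pi)) • α) i) -
        round (((s * |z| / (2 * Real.pi)) • α) i)) ^ 2 := by
        gcongr
        exact infDist_integerLattice_sq_le _
    _ ≤ _ := by
        rw [Finset.mul_sum]
        refine Finset.sum_le_sum fun i _ => (eight_mul_sub_round_sq_le _).trans_eq ?_
        have h : 2 * Real.pi * (((s * |z| / (2 * Real.pi)) • α) i) = s * α i * |z| := by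
          simp only [PiLp.smul_apply, smul_eq_mul]
          field_simp
        rw [h]
        rcases abs_choice z with hz | hz <;> rw [hz]
        rw [mul_neg, Real.cos_neg]

/-- For a fixed value of the second copy, a difference smaller than δ/2 confines the first copy to
an interval of length δ. -/
theorem symmetrization_real_ge (μ : Measure ℝ) [IsProbabilityMeasure μ] {δ p : ℝ}
    (h : ∀ a, μ.real (Set.Icc a (a + δ)) ≤ p) :
    1 - p ≤ (symmetrization μ).real {z | δ / 2 ≤ |z|} := by
  set ν := μ.map fun x => -1 * x with hν
  have : IsProbabilityMeasure ν := Measure.isProbabilityMeasure_map (by fun_prop)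
  have hA : MeasurableSet {z : ℝ | |z| < δ / 2} :=
    (isOpen_lt continuous_abs continuous_const).measurableSet
  have hcompl : {z : ℝ | δ / 2 ≤ |z|} = {z : ℝ | |z| < δ / 2}ᶜ := by
    ext z
    simp
  have hp : 0 ≤ p := measureReal_nonneg.trans (h 0)
  rw [hcompl, probReal_compl_eq_one_sub hA]
  suffices (symmetrization μ) {z | |z| < δ / 2} ≤ ENNReal.ofReal p by
    have := ENNReal.toReal_le_of_le_ofReal hp this
    simp only [Measure.real]
    linarith
  rw [symmetrization, ← hν, Measure.map_apply (by fun_prop) hA,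
    Measure.prod_apply_symm ((by fun_prop : Measurable fun z : ℝ × ℝ => z.1 + z.2) hA)]
  calc _ ≤ ∫⁻ _y, ENNReal.ofReal p ∂ν := by
        refine lintegral_mono fun y => ?_
        rw [← ofReal_measureReal]
        refine ENNReal.ofReal_le_ofReal ((measureReal_mono ?_).trans (h (-y - δ / 2)))
        intro x hx
        simp only [Set.mem_preimage, Set.mem_ofPred_eq, abs_lt] at hx
        constructor <;> linarith [hx.1, hx.2]
    _ = _ := by simp

/-! ### Small ball probabilities of linear forms. -/

section SmallBall

variable {n : ℕ} {Ω : Type*} [MeasurableSpace Ω] {P : Measure Ω}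
  {X : Fin n → Ω → ℝ} {μ : Measure ℝ} [IsProbabilityMeasure μ]

theorem norm_charFun_linearForm_le (hX : ∀ i, Measurable (X i)) (hind : iIndepFun X P)
    (hμ : ∀ i, P.map (X i) = μ) (α : EuclideanSpace ℝ (Fin n)) (s : ℝ) :
    ‖charFun (P.map (linearForm α X)) s‖ ≤
      Real.exp (-(∫ z, ∑ i, (1 - Real.cos (s * α i * z)) ∂symmetrization μ) / 2) := by
  have hind' : iIndepFun (fun i ω => α i * X i ω) P :=
    hind.comp (fun i x => α i * x) fun i => by fun_prop
  have hlf : linearForm α X = fun ω => ∑ i, α i * X i ω := rfl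
  rw [hlf, iIndepFun.charFun_map_fun_sum_eq_prod (fun i => by fun_prop) hind', Finset.prod_apply,
    norm_prod, integral_finsetSum]
  · rw [← Finset.sum_neg_distrib, Finset.sum_div, Real.exp_sum]
    refine Finset.prod_le_prod (fun _ _ => norm_nonneg _) fun i _ => ?_
    rw [charFun_map_mul_comp (by fun_prop), hμ, mul_comm s]
    exact norm_charFun_le_exp μ _
  · intro i _
    exact (integrable_const _).sub (Integrable.of_bound (by fun_prop) 1
      (Filter.Eventually.of_forall fun z => Real.abs_cos_le_one _))

/-- The summands 1 − cos are nonnegative, so restricting the average to A costs only the factor q.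
Jensen then takes the average out of the exponential, so that the frequency can later be integrated
with z fixed. The constant is 4q = 8 · q/2. -/
theorem norm_charFun_linearForm_le_integral_cond (hX : ∀ i, Measurable (X i))
    (hind : iIndepFun X P) (hμ : ∀ i, P.map (X i) = μ) (α : EuclideanSpace ℝ (Fin n)) (s : ℝ)
    {A : Set ℝ} {q : ℝ} (hq : 0 < q) (hqA : q ≤ (symmetrization μ).real A) :
    ‖charFun (P.map (linearForm α X)) s‖ ≤
      ∫ z, Real.exp (-(4 * q) * Metric.infDist ((s * |z| / (2 * Real.pi)) • α)
        (integerLattice n) ^ 2) ∂(symmetrization μ)[|A] := by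
  set ρ := symmetrization μ
  have hA0 : ρ A ≠ 0 := by
    intro h
    rw [Measure.real, h] at hqA
    simp at hqA
    linarith
  have : IsProbabilityMeasure ρ[|A] := cond_isProbabilityMeasure hA0
  set G : ℝ → ℝ := fun z => ∑ i, (1 - Real.cos (s * α i * z)) with hG
  have hG0 : ∀ z, 0 ≤ G z := fun z =>
    Finset.sum_nonneg fun i _ => by linarith [Real.cos_le_one (s * α i * z)]
  have hGint : ∀ κ : Measure ℝ, IsProbabilityMeasure κ → Integrable G κ := fun κ _ =>
    integrable_finsetSum _ fun i _ => (integrable_const _).sub (Integrable.of_bound (by fun_prop) 1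
      (Filter.Eventually.of_forall fun z => Real.abs_cos_le_one _))
  have hGc : Continuous G := by fun_prop
  have hfc : Continuous fun z : ℝ => Real.exp (-(4 * q) *
      Metric.infDist ((s * |z| / (2 * Real.pi)) • α) (integerLattice n) ^ 2) := by
    have := (continuous_infDist_smul α).comp
      (by fun_prop : Continuous fun z : ℝ => s * |z| / (2 * Real.pi))
    simp only [Function.comp_def] at this
    fun_prop
  have hcond : q * ∫ z, G z ∂ρ[|A] ≤ ∫ z, G z ∂ρ := by
    have h1 : ρ.real A * ∫ z, G z ∂ρ[|A] = ∫ z in A, G z ∂ρ := by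
      rw [ProbabilityTheory.cond, integral_smul_measure, ENNReal.toReal_inv, smul_eq_mul,
        ← mul_assoc]
      have : (ρ A).toReal ≠ 0 := (hq.trans_le hqA).ne'
      simp only [Measure.real]
      rw [mul_inv_cancel₀ this, one_mul]
    calc _ ≤ ρ.real A * ∫ z, G z ∂ρ[|A] := by
          gcongr
          exact integral_nonneg hG0
      _ = _ := h1
      _ ≤ _ := setIntegral_le_integral (hGint ρ inferInstance) (Filter.Eventually.of_forall hG0)
  have hexpint : Integrable (fun z => Real.exp (-(q / 2) * G z)) ρ[|A] := by
    refine Integrable.of_bound (by fun_prop) 1 (Filter.Eventually.of_forall fun z => ?_)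
    rw [Real.norm_eq_abs, Real.abs_exp, Real.exp_le_one_iff]
    nlinarith [hG0 z, mul_nonneg hq.le (hG0 z)]
  calc _ ≤ Real.exp (-(∫ z, G z ∂ρ) / 2) := norm_charFun_linearForm_le hX hind hμ α s
    _ ≤ Real.exp (∫ z, -(q / 2) * G z ∂ρ[|A]) := by
        rw [integral_const_mul]
        gcongr
        linarith
    _ ≤ ∫ z, Real.exp (-(q / 2) * G z) ∂ρ[|A] :=
        convexOn_exp.map_integral_le Real.continuous_exp.continuousOn isClosed_univ
          (Filter.Eventually.of_forall fun _ => Set.mem_univ _) ((hGint _ inferInstance).const_mul _) hexpint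
    _ ≤ _ := by
        refine integral_mono hexpint ?_ fun z => ?_
        · refine Integrable.of_bound hfc.aestronglyMeasurable 1
            (Filter.Eventually.of_forall fun z => ?_)
          rw [Real.norm_eq_abs, Real.abs_exp, Real.exp_le_one_iff, neg_mul, neg_nonpos]
          positivity
        · refine Real.exp_le_exp.2 ?_
          nlinarith [mul_le_mul_of_nonneg_left (infDist_sq_le_sum_one_sub_cos α s z) hq.le]

variable [IsProbabilityMeasure P]

theorem measureReal_abs_linearForm_le_of_pos (hX : ∀ i, Measurable (X i))
    (hind : iIndepFun X P) (hμ : ∀ i, P.map (X i) = μ) {δ p : ℝ} (hδ : 0 < δ) (hp : p < 1)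
    (hconc : ∀ a, μ.real (Set.Icc a (a + δ)) ≤ p) {α : EuclideanSpace ℝ (Fin n)} (hα : ‖α‖ = 1)
    {γ t : ℝ} (hγ : 0 < γ) (ht : 0 < t) :
    P.real {ω | |linearForm α X ω| ≤ t} ≤ 4 * (Real.exp (-(1 - p) * γ ^ 2) +
      Real.sqrt (Real.pi / ((1 - p) / 100)) * (4 * Real.pi / δ * t + 1 / essentialLCD γ α)) := by
  set q := 1 - p with hq
  have hq0 : 0 < q := by linarith
  set A : Set ℝ := {z | δ / 2 ≤ |z|} with hAdef
  have hA : MeasurableSet A := (isClosed_le continuous_const continuous_abs).measurableSet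
  set ρ := symmetrization μ
  have hqA : q ≤ ρ.real A := symmetrization_real_ge μ hconc
  have hA0 : ρ A ≠ 0 := by
    intro h
    rw [Measure.real, h] at hqA
    simp at hqA
    linarith
  have : IsProbabilityMeasure ρ[|A] := cond_isProbabilityMeasure hA0
  have hS : Measurable (linearForm α X) := by
    unfold linearForm
    fun_prop
  have : IsProbabilityMeasure (P.map (linearForm α X)) :=
    Measure.isProbabilityMeasure_map hS.aemeasurable
  have hset : P.real {ω | |linearForm α X ω| ≤ t} =
      (P.map (linearForm α X)).real {x | |x| ≤ t} := by
    rw [map_measureReal_apply hS (isClosed_le continuous_abs continuous_const).measurableSet]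
    rfl
  rw [hset]
  refine (measureReal_abs_le_le_integral_norm_charFun _ ht).trans ?_
  gcongr
  set H : ℝ → ℝ → ℝ := fun u z => Real.exp (-(4 * q) *
    Metric.infDist ((u / t * |z| / (2 * Real.pi)) • α) (integerLattice n) ^ 2) with hH
  have hHc : Continuous (Function.uncurry H) := by
    have := (continuous_infDist_smul α).comp
      (by fun_prop : Continuous fun z : ℝ × ℝ => z.1 / t * |z.2| / (2 * Real.pi))
    simp only [Function.comp_def] at this
    simp only [hH, Function.uncurry_def]
    fun_prop
  have hHb : ∀ u z, ‖H u z‖ ≤ 1 := by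
    intro u z
    rw [hH, Real.norm_eq_abs, Real.abs_exp, Real.exp_le_one_iff, neg_mul, neg_nonpos]
    positivity
  have hHint : Integrable (Function.uncurry H) ((volume.restrict (Set.Ioc 0 1)).prod ρ[|A]) :=
    Integrable.of_bound hHc.aestronglyMeasurable 1
      (Filter.Eventually.of_forall fun z => hHb z.1 z.2)
  have hle : ∫ u in (0 : ℝ)..1, ‖charFun (P.map (linearForm α X)) (u / t)‖ ≤
      ∫ u in (0 : ℝ)..1, ∫ z, H u z ∂ρ[|A] := by
    have hcm : Measurable (charFun (P.map (linearForm α X))) := measurable_charFun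
    refine intervalIntegral.integral_mono_on zero_le_one ?_ ?_ fun u _ =>
      norm_charFun_linearForm_le_integral_cond hX hind hμ α (u / t) hq0 hqA
    · rw [intervalIntegrable_iff, Set.uIoc_of_le zero_le_one]
      refine Integrable.of_bound (by fun_prop) 1 (Filter.Eventually.of_forall fun u => ?_)
      rw [norm_norm]
      exact norm_charFun_le_one _
    · rw [intervalIntegrable_iff, Set.uIoc_of_le zero_le_one]
      exact hHint.integral_prod_left
  refine hle.trans ?_
  rw [intervalIntegral.integral_of_le zero_le_one, integral_integral_swap hHint]
  calc ∫ z, (∫ u in Set.Ioc 0 1, H u z) ∂ρ[|A]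
      ≤ ∫ _z, (Real.exp (-q * γ ^ 2) + Real.sqrt (Real.pi / (q / 100)) *
          (4 * Real.pi / δ * t + 1 / essentialLCD γ α)) ∂ρ[|A] := by
        refine integral_mono_ae hHint.integral_prod_right (integrable_const _) ?_
        filter_upwards [ae_cond_mem hA] with z hz
        have hz' : δ / 2 ≤ |z| := hz
        have hz0 : 0 < |z| := by linarith
        -- As u runs over [0, 1] the multiplier of α runs over [0, L] with this L, and |z| ≥ δ/2
        -- gives 1/L ≤ 4πt/δ. The choice b = 4q turns b/4 into 1 − p.
        have hL : 0 < |z| / (2 * Real.pi * t) := by positivity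
        have hmain := integral_exp_infDist_le hα hγ (by positivity : 0 < 4 * q) hL
        rw [intervalIntegral.integral_of_le zero_le_one] at hmain
        have heq : ∫ u in Set.Ioc (0 : ℝ) 1, H u z = ∫ u in Set.Ioc (0 : ℝ) 1, Real.exp (-(4 * q) *
            Metric.infDist ((|z| / (2 * Real.pi * t) * u) • α) (integerLattice n) ^ 2) := by
          refine integral_congr_ae (Filter.Eventually.of_forall fun u => ?_)
          simp only [hH]
          congr 6
          field_simp
        rw [heq]
        refine hmain.trans ?_
        rw [show 4 * q / 4 = q by ring, show 4 * q / 400 = q / 100 by ring]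
        gcongr
        rw [one_div_div, div_mul_eq_mul_div, div_le_div_iff₀ hz0 hδ]
        nlinarith [mul_pos Real.pi_pos ht]
    _ = _ := by simp

/-- The small ball probability of a linear form is controlled by the essential LCD. -/
theorem measureReal_abs_linearForm_le (hX : ∀ i, Measurable (X i))
    (hind : iIndepFun X P) (hμ : ∀ i, P.map (X i) = μ) {δ p : ℝ} (hδ : 0 < δ) (hp : p < 1)
    (hconc : ∀ a, μ.real (Set.Icc a (a + δ)) ≤ p) {α : EuclideanSpace ℝ (Fin n)} (hα : ‖α‖ = 1)
    {γ t : ℝ} (hγ : 0 < γ) (ht : 0 ≤ t) :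
    P.real {ω | |linearForm α X ω| ≤ t} ≤ 4 * (Real.exp (-(1 - p) * γ ^ 2) +
      Real.sqrt (Real.pi / ((1 - p) / 100)) * (4 * Real.pi / δ * t + 1 / essentialLCD γ α)) := by
  have hcont : Continuous fun t : ℝ => 4 * (Real.exp (-(1 - p) * γ ^ 2) +
      Real.sqrt (Real.pi / ((1 - p) / 100)) *
        (4 * Real.pi / δ * t + 1 / essentialLCD γ α)) := by fun_prop
  -- Radius zero, needed when β = 0, is reached by letting s decrease to t.
  refine ge_of_tendsto (hcont.continuousWithinAt (s := Set.Ioi t)) ?_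
  filter_upwards [self_mem_nhdsWithin] with s hs
  refine (measureReal_mono fun ω hω => ?_).trans
    (measureReal_abs_linearForm_le_of_pos hX hind hμ hδ hp hconc hα hγ (ht.trans_lt hs))
  exact le_trans hω (le_of_lt (Set.mem_Ioi.1 hs))

end SmallBall

/-! ### From the tail bound to a sub-Gaussian moment generating function. -/

/-- The linear term integrates to zero for a centred variable, leaving a bound without a first-order
term in x. -/
theorem exp_le_add_exp_sq (x : ℝ) : Real.exp x ≤ x + Real.exp (x ^ 2) := by
  have h := Real.add_one_le_exp (x ^ 2)
  rcases le_or_gt |x| 1 with h1 | h1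
  · have := (abs_le.1 (Real.abs_exp_sub_one_sub_id_le h1)).2
    linarith
  · rcases lt_abs.1 h1 with h2 | h2
    · have : Real.exp x ≤ Real.exp (x ^ 2) := Real.exp_le_exp.2 (by nlinarith)
      linarith
    · have : Real.exp x ≤ 1 := Real.exp_le_one_iff.2 (by linarith)
      nlinarith

section Subgaussian

variable {Ω : Type*} [MeasurableSpace Ω] {P : Measure Ω} [IsProbabilityMeasure P] {Y : Ω → ℝ}
  {C c : ℝ}

/-- Layer cake: e^{cy²/2} − 1 is the primitive of ct e^{ct²/2}, and the tail bound leaves Cct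
e^{−ct²/2}, whose integral over the half-line is C. -/
theorem lintegral_exp_sq_sub_one_le (hC : 0 < C) (hc : 0 < c) (hY : Measurable Y)
    (htail : ∀ t : ℝ, 0 < t → P.real {ω | t ≤ |Y ω|} ≤ C * Real.exp (-c * t ^ 2)) :
    ∫⁻ ω, ENNReal.ofReal (Real.exp (c / 2 * Y ω ^ 2) - 1) ∂P ≤ ENNReal.ofReal C := by
  have hprim : ∀ y : ℝ, ∫ t in (0 : ℝ)..y, c * t * Real.exp (c / 2 * t ^ 2) =
      Real.exp (c / 2 * y ^ 2) - 1 := by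
    intro y
    rw [intervalIntegral.integral_eq_sub_of_hasDerivAt
      (f := fun t => Real.exp (c / 2 * t ^ 2)) (fun t _ => ?_)
      (Continuous.intervalIntegrable (by fun_prop) _ _)]
    · simp
    · refine ((hasDerivAt_pow 2 t).const_mul (c / 2)).exp.congr_deriv ?_
      simp
      ring
  have hlayer := lintegral_comp_eq_lintegral_meas_le_mul P (f := fun ω => |Y ω|)
    (g := fun t => c * t * Real.exp (c / 2 * t ^ 2))
    (Filter.Eventually.of_forall fun ω => abs_nonneg _) (by fun_prop)
    (fun t _ => Continuous.intervalIntegrable (by fun_prop) _ _)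
    ((ae_restrict_mem measurableSet_Ioi).mono fun t ht => by
      have : 0 < t := ht
      positivity)
  simp only [hprim, sq_abs] at hlayer
  rw [hlayer]
  have hint : IntegrableOn (fun t : ℝ => t * Real.exp (-(c / 2) * t ^ 2)) (Set.Ioi 0) :=
    (integrable_mul_exp_neg_mul_sq (by positivity : 0 < c / 2)).integrableOn
  have hval : ∫ t in Set.Ioi (0 : ℝ), t * Real.exp (-(c / 2) * t ^ 2) = 1 / c := by
    have := integral_mul_cexp_neg_mul_sq (b := ((c / 2 : ℝ) : ℂ)) (by simpa using hc)
    have h2 : ((∫ t in Set.Ioi (0 : ℝ), t * Real.exp (-(c / 2) * t ^ 2) : ℝ) : ℂ) =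
        ((1 / c : ℝ) : ℂ) := by
      rw [← integral_complex_ofReal]
      push_cast at this ⊢
      rw [this]
      have : (c : ℂ) ≠ 0 := by exact_mod_cast hc.ne'
      field_simp
    exact_mod_cast h2
  calc _ ≤ ∫⁻ t in Set.Ioi (0 : ℝ),
        ENNReal.ofReal (C * c * (t * Real.exp (-(c / 2) * t ^ 2))) := by
        refine setLIntegral_mono' measurableSet_Ioi fun t ht => ?_
        have ht0 : 0 < t := ht
        rw [← ofReal_measureReal, ← ENNReal.ofReal_mul measureReal_nonneg]
        refine ENNReal.ofReal_le_ofReal ?_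
        calc _ ≤ C * Real.exp (-c * t ^ 2) * (c * t * Real.exp (c / 2 * t ^ 2)) := by
              gcongr
              exact htail t ht0
          _ = C * c * (t * (Real.exp (-c * t ^ 2) * Real.exp (c / 2 * t ^ 2))) := by ring
          _ = _ := by
              rw [← Real.exp_add]
              congr 4
              ring
    _ = _ := by
        rw [← ofReal_integral_eq_lintegral_ofReal (hint.const_mul _)
          ((ae_restrict_mem measurableSet_Ioi).mono fun t ht => by
            have : 0 < t := ht
            positivity), integral_const_mul, hval]
        congr 1
        field_simp

theorem integrable_exp_sq (hC : 0 < C) (hc : 0 < c) (hY : Measurable Y)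
    (htail : ∀ t : ℝ, 0 < t → P.real {ω | t ≤ |Y ω|} ≤ C * Real.exp (-c * t ^ 2)) :
    Integrable (fun ω => Real.exp (c / 2 * Y ω ^ 2)) P ∧
      ∫ ω, Real.exp (c / 2 * Y ω ^ 2) ∂P ≤ 1 + C := by
  have hle := lintegral_exp_sq_sub_one_le hC hc hY htail
  have hnn : ∀ ω, 0 ≤ Real.exp (c / 2 * Y ω ^ 2) - 1 := fun ω =>
    sub_nonneg.2 (Real.one_le_exp (by positivity))
  have hint : Integrable (fun ω => Real.exp (c / 2 * Y ω ^ 2) - 1) P := by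
    refine ⟨by fun_prop, ?_⟩
    rw [hasFiniteIntegral_iff_ofReal (Filter.Eventually.of_forall hnn)]
    exact hle.trans_lt ENNReal.ofReal_lt_top
  have hint' : Integrable (fun ω => Real.exp (c / 2 * Y ω ^ 2)) P := by
    exact (hint.add (integrable_const (1 : ℝ))).congr
      (Filter.Eventually.of_forall fun ω => by simp)
  refine ⟨hint', ?_⟩
  have : ∫ ω, (Real.exp (c / 2 * Y ω ^ 2) - 1) ∂P ≤ C := by
    rw [integral_eq_lintegral_of_nonneg_ae (Filter.Eventually.of_forall hnn) (by fun_prop)]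
    exact ENNReal.toReal_le_of_le_ofReal hC.le hle
  rw [integral_sub hint' (integrable_const _)] at this
  simp at this
  linarith

/-- The variance proxy obtained from the tail bound `C exp (-c t²)`. -/
noncomputable def varianceProxy (C c : ℝ) : ℝ := 2 * ((1 / 2 + 2 * Real.log (1 + C)) / c)

theorem varianceProxy_pos (hC : 0 < C) (hc : 0 < c) : 0 < varianceProxy C c := by
  have := Real.log_pos (by linarith : 1 < 1 + C)
  unfold varianceProxy
  positivity

theorem hasSubgaussianMGF_of_tail (hC : 0 < C) (hc : 0 < c) (hY : Measurable Y)
    (htail : ∀ t : ℝ, 0 < t → P.real {ω | t ≤ |Y ω|} ≤ C * Real.exp (-c * t ^ 2))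
    (hmean : ∫ ω, Y ω ∂P = 0) :
    HasSubgaussianMGF Y (varianceProxy C c).toNNReal P := by
  obtain ⟨hint, hle⟩ := integrable_exp_sq hC hc hY htail
  set M := Real.log (1 + C) with hM
  have hM0 : 0 < M := Real.log_pos (by linarith)
  have hexpM : Real.exp M = 1 + C := Real.exp_log (by linarith)
  have hpt : ∀ s y : ℝ, s * y ≤ s ^ 2 / (2 * c) + c / 2 * y ^ 2 := by
    intro s y
    have h : s ^ 2 / (2 * c) + c / 2 * y ^ 2 - s * y = (s - c * y) ^ 2 / (2 * c) := by
      field_simp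
      ring
    have : 0 ≤ (s - c * y) ^ 2 / (2 * c) := by positivity
    linarith
  have hdom : ∀ s : ℝ, Integrable (fun ω => Real.exp (s ^ 2 / (2 * c)) *
      Real.exp (c / 2 * Y ω ^ 2)) P := fun s => hint.const_mul _
  have hpt' : ∀ s ω, Real.exp (s * Y ω) ≤
      Real.exp (s ^ 2 / (2 * c)) * Real.exp (c / 2 * Y ω ^ 2) := fun s ω => by
    rw [← Real.exp_add]
    exact Real.exp_le_exp.2 (hpt s _)
  have hexp : ∀ s, Integrable (fun ω => Real.exp (s * Y ω)) P := fun s =>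
    (hdom s).mono' (by fun_prop) (Filter.Eventually.of_forall fun ω => by
      rw [Real.norm_eq_abs, Real.abs_exp]
      exact hpt' s ω)
  have hYint : Integrable Y P := by
    refine ((hexp 1).add (hexp (-1))).mono' (by fun_prop) (Filter.Eventually.of_forall fun ω => ?_)
    have h1 := Real.add_one_le_exp (1 * Y ω)
    have h2 := Real.add_one_le_exp (-1 * Y ω)
    have h3 := Real.exp_pos (1 * Y ω)
    have h4 := Real.exp_pos (-1 * Y ω)
    rw [Real.norm_eq_abs, Pi.add_apply]
    refine abs_le.2 ⟨by linarith, by linarith⟩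
  refine ⟨hexp, fun s => ?_⟩
  rw [Real.coe_toNNReal _ (varianceProxy_pos hC hc).le, mgf]
  have hexponent : varianceProxy C c * s ^ 2 / 2 = (1 / 2 + 2 * M) / c * s ^ 2 := by
    rw [varianceProxy, ← hM]
    ring
  rw [hexponent]
  -- For small s, centring removes the linear term and Jensen for the concave power θ = 2s²/c ≤ 1
  -- gives (1 + C)^θ = exp(2Ms²/c). For large s, the inequality sy ≤ s²/(2c) + cy²/2 costs a factor
  -- e^M, which is below exp(2Ms²/c). The two terms of the variance proxy cover both ranges.
  rcases le_or_gt (s ^ 2) (c / 2) with hs | hs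
  · set θ := 2 * s ^ 2 / c with hθ
    have hθ0 : 0 ≤ θ := by positivity
    have hθ1 : θ ≤ 1 := by
      rw [hθ, div_le_one hc]
      linarith
    have hpow : ∀ ω, Real.exp ((s * Y ω) ^ 2) = Real.exp (c / 2 * Y ω ^ 2) ^ θ := fun ω => by
      rw [← Real.exp_mul, hθ]
      congr 1
      field_simp
    have hsq : Integrable (fun ω => Real.exp ((s * Y ω) ^ 2)) P := by
      refine hint.mono' (by fun_prop) (Filter.Eventually.of_forall fun ω => ?_)
      rw [Real.norm_eq_abs, Real.abs_exp, Real.exp_le_exp, mul_pow]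
      gcongr
    have hjensen : ∫ ω, Real.exp ((s * Y ω) ^ 2) ∂P ≤ (1 + C) ^ θ := by
      calc _ = ∫ ω, Real.exp (c / 2 * Y ω ^ 2) ^ θ ∂P := by simp only [hpow]
        _ ≤ (∫ ω, Real.exp (c / 2 * Y ω ^ 2) ∂P) ^ θ := by
            refine (Real.concaveOn_rpow hθ0 hθ1).le_map_integral
              (Real.continuous_rpow_const hθ0).continuousOn isClosed_Ici
              (Filter.Eventually.of_forall fun ω => (Real.exp_pos _).le) hint ?_
            simpa only [Function.comp_def, ← hpow] using hsq
        _ ≤ _ := Real.rpow_le_rpow (integral_nonneg fun ω => (Real.exp_pos _).le) hle hθ0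
    calc ∫ ω, Real.exp (s * Y ω) ∂P
        ≤ ∫ ω, (s * Y ω + Real.exp ((s * Y ω) ^ 2)) ∂P :=
          integral_mono (hexp s) ((hYint.const_mul s).add hsq) fun ω => exp_le_add_exp_sq _
      _ = ∫ ω, Real.exp ((s * Y ω) ^ 2) ∂P := by
          rw [integral_add (hYint.const_mul s) hsq, integral_const_mul, hmean]
          ring
      _ ≤ (1 + C) ^ θ := hjensen
      _ = Real.exp (M * θ) := by rw [← hexpM, ← Real.exp_mul]
      _ ≤ _ := by
          refine Real.exp_le_exp.2 ?_
          have h : (1 / 2 + 2 * M) / c * s ^ 2 - M * θ = s ^ 2 / (2 * c) := by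
            rw [hθ]
            field_simp
            ring
          have : 0 ≤ s ^ 2 / (2 * c) := by positivity
          linarith
  · calc ∫ ω, Real.exp (s * Y ω) ∂P
        ≤ ∫ ω, Real.exp (s ^ 2 / (2 * c)) * Real.exp (c / 2 * Y ω ^ 2) ∂P :=
          integral_mono (hexp s) (hdom s) (hpt' s)
      _ ≤ Real.exp (s ^ 2 / (2 * c)) * Real.exp M := by
          rw [integral_const_mul, hexpM]
          gcongr
      _ ≤ _ := by
          rw [← Real.exp_add]
          refine Real.exp_le_exp.2 ?_
          have h : (1 / 2 + 2 * M) / c * s ^ 2 - (s ^ 2 / (2 * c) + M) =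
              M * ((2 * s ^ 2 - c) / c) := by
            field_simp
            ring
          have : 0 ≤ M * ((2 * s ^ 2 - c) / c) :=
            mul_nonneg hM0.le (div_nonneg (by linarith) hc.le)
          linarith

/-- Hoeffding inequality for a linear form. -/
theorem measureReal_le_abs_linearForm_le {n : ℕ} {X : Fin n → Ω → ℝ} (hC : 0 < C) (hc : 0 < c)
    (hX : ∀ i, Measurable (X i)) (hind : iIndepFun X P)
    (htail : ∀ i, ∀ t : ℝ, 0 < t → P.real {ω | t ≤ |X i ω|} ≤ C * Real.exp (-c * t ^ 2))
    (hmean : ∀ i, ∫ ω, X i ω ∂P = 0) (β : EuclideanSpace ℝ (Fin n)) {s : ℝ} (hs : 0 ≤ s) :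
    P.real {ω | s ≤ |linearForm β X ω|} ≤
      2 * Real.exp (-s ^ 2 / (2 * (varianceProxy C c * ‖β‖ ^ 2))) := by
  have hind' : iIndepFun (fun i ω => β i * X i ω) P :=
    hind.comp (fun i x => β i * x) fun i => by fun_prop
  have hsub := HasSubgaussianMGF.sum_of_iIndepFun hind' (s := Finset.univ) fun i _ =>
    (hasSubgaussianMGF_of_tail hC hc (hX i) (htail i) (hmean i)).const_mul (β i)
  set v : NNReal := _
  change HasSubgaussianMGF (linearForm β X) v P at hsub
  have hv : (v : ℝ) = varianceProxy C c * ‖β‖ ^ 2 := by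
    simp only [v, EuclideanSpace.norm_sq_eq, Finset.mul_sum]
    push_cast
    refine Finset.sum_congr rfl fun i _ => ?_
    change β i ^ 2 * ((varianceProxy C c).toNNReal : ℝ) = _
    rw [Real.coe_toNNReal _ (varianceProxy_pos hC hc).le, Real.norm_eq_abs, sq_abs, mul_comm]
  have h1 := hsub.measure_ge_le hs
  have h2 := hsub.neg.measure_ge_le hs
  rw [hv] at h1 h2
  calc _ ≤ P.real ({ω | s ≤ linearForm β X ω} ∪ {ω | s ≤ (-linearForm β X) ω}) :=
        measureReal_mono fun ω hω => by
          simpa [le_abs] using hω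
    _ ≤ _ := (measureReal_union_le _ _).trans (by linarith)

end Subgaussian

/-! ### Comparison of the two linear forms. -/

theorem linearForm_smul {Ω : Type*} {n : ℕ} (a : ℝ) (α : EuclideanSpace ℝ (Fin n))
    (X : Fin n → Ω → ℝ) (ω : Ω) : linearForm (a • α) X ω = a * linearForm α X ω := by
  simp [linearForm, Finset.mul_sum, mul_assoc]

theorem measureReal_Icc_le_of_levyConcentration_le {Ω : Type*} [MeasurableSpace Ω]
    {P : Measure Ω} [IsProbabilityMeasure P] {Y : Ω → ℝ} (hY : Measurable Y) {δ p : ℝ}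
    (h : levyConcentration P Y δ ≤ p) (a : ℝ) : (P.map Y).real (Set.Icc a (a + δ)) ≤ p := by
  rw [map_measureReal_apply hY measurableSet_Icc]
  refine le_trans ?_ h
  exact le_ciSup (f := fun a : ℝ => P.real {ω | a ≤ Y ω ∧ Y ω ≤ a + δ})
    ⟨1, by rintro _ ⟨b, rfl⟩; exact measureReal_le_one⟩ a

/-- The comparison bound with the threshold `s` separating the two linear forms. -/
theorem measureReal_abs_linearForm_le_abs_linearForm {Ω : Type*} {n : ℕ} [MeasurableSpace Ω]
    {P : Measure Ω} [IsProbabilityMeasure P] {X : Fin n → Ω → ℝ} {C c δ p : ℝ}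
    (hC : 0 < C) (hc : 0 < c) (hδ : 0 < δ) (hp : p < 1)
    (hX : ∀ i, Measurable (X i)) (hind : iIndepFun X P)
    (hid : ∀ i j, IdentDistrib (X i) (X j) P P)
    (htail : ∀ i, ∀ t : ℝ, 0 < t → P.real {ω | t ≤ |X i ω|} ≤ C * Real.exp (-c * t ^ 2))
    (hmean : ∀ i, ∫ ω, X i ω ∂P = 0) (hconc : ∀ i, levyConcentration P (X i) δ ≤ p)
    {α β : EuclideanSpace ℝ (Fin n)} {γ : ℝ} (hα : α ≠ 0) (hγ : 0 < γ)
    (hβ : ‖β‖ < ‖α‖) :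
    P.real {ω | |linearForm α X ω| ≤ |linearForm β X ω|} ≤
      4 * (Real.exp (-(1 - p) * γ ^ 2) + Real.sqrt (Real.pi / ((1 - p) / 100)) *
        (4 * Real.pi / δ * (Real.sqrt (2 * varianceProxy C c) *
          (‖β‖ / ‖α‖ * Real.sqrt (Real.log (‖α‖ / ‖β‖)))) +
            1 / essentialLCD γ (‖α‖⁻¹ • α))) + 2 * (‖β‖ / ‖α‖) := by
  have hα0 : 0 < ‖α‖ := norm_pos_iff.2 hα
  obtain ⟨i₀⟩ : Nonempty (Fin n) := by
    by_contra h
    rw [not_nonempty_iff] at h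
    exact hα (Subsingleton.elim _ _)
  have : IsProbabilityMeasure (P.map (X i₀)) :=
    Measure.isProbabilityMeasure_map (hX i₀).aemeasurable
  have hunit : ‖‖α‖⁻¹ • α‖ = 1 := by rw [norm_smul, norm_inv, norm_norm, inv_mul_cancel₀ hα0.ne']
  have hform : ∀ ω, |linearForm α X ω| = ‖α‖ * |linearForm (‖α‖⁻¹ • α) X ω| := fun ω => by
    rw [linearForm_smul, abs_mul, abs_inv, abs_norm, mul_inv_cancel_left₀ hα0.ne']
  have hball : ∀ t : ℝ, 0 ≤ t → _ := fun t ht =>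
    measureReal_abs_linearForm_le hX hind (fun i => (hid i i₀).map_eq) hδ hp
      (measureReal_Icc_le_of_levyConcentration_le (hX i₀) (hconc i₀)) hunit hγ ht
  rcases eq_or_ne β 0 with rfl | hβ0
  · refine (measureReal_mono fun ω hω => ?_).trans ((hball 0 le_rfl).trans (by simp))
    have h0 : linearForm (0 : EuclideanSpace ℝ (Fin n)) X ω = 0 := by simp [linearForm]
    have hω' : |linearForm α X ω| ≤ |linearForm 0 X ω| := hω
    rw [h0, abs_zero, hform] at hω'
    exact nonpos_of_mul_nonpos_right hω' hα0
  · have hβpos : 0 < ‖β‖ := norm_pos_iff.2 hβ0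
    have hκ := varianceProxy_pos hC hc
    have hlog : 0 < Real.log (‖α‖ / ‖β‖) := Real.log_pos ((one_lt_div hβpos).2 hβ)
    -- This τ makes the Hoeffding exponential at level τ‖β‖ equal to ‖β‖/‖α‖ exactly.
    set τ := Real.sqrt (2 * varianceProxy C c) * Real.sqrt (Real.log (‖α‖ / ‖β‖)) with hτ
    have hτ0 : 0 ≤ τ := by positivity
    have hτsq : τ ^ 2 = 2 * varianceProxy C c * Real.log (‖α‖ / ‖β‖) := by
      rw [hτ, mul_pow, Real.sq_sqrt (by positivity), Real.sq_sqrt hlog.le]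
    have htailβ := measureReal_le_abs_linearForm_le hC hc hX hind htail hmean β
      (by positivity : 0 ≤ τ * ‖β‖)
    have hexp : Real.exp (-(τ * ‖β‖) ^ 2 / (2 * (varianceProxy C c * ‖β‖ ^ 2))) = ‖β‖ / ‖α‖ := by
      have : -(τ * ‖β‖) ^ 2 / (2 * (varianceProxy C c * ‖β‖ ^ 2)) = -Real.log (‖α‖ / ‖β‖) := by
        rw [mul_pow, hτsq]
        field_simp
      rw [this, Real.exp_neg, Real.exp_log (by positivity), inv_div]
    rw [hexp] at htailβ
    have hsub : {ω | |linearForm α X ω| ≤ |linearForm β X ω|} ⊆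
        {ω | |linearForm (‖α‖⁻¹ • α) X ω| ≤ τ * (‖β‖ / ‖α‖)} ∪
          {ω | τ * ‖β‖ ≤ |linearForm β X ω|} := by
      intro ω hω
      have hω' : |linearForm α X ω| ≤ |linearForm β X ω| := hω
      rcases le_total (τ * ‖β‖) |linearForm β X ω| with h | h
      · exact Or.inr h
      · refine Or.inl (?_ : |linearForm (‖α‖⁻¹ • α) X ω| ≤ τ * (‖β‖ / ‖α‖))
        rw [← mul_div_assoc, le_div_iff₀ hα0, mul_comm, ← hform]
        exact hω'.trans h
    refine (measureReal_mono hsub).trans ((measureReal_union_le _ _).trans (add_le_add ?_ htailβ))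
    refine (hball (τ * (‖β‖ / ‖α‖)) (by positivity)).trans_eq ?_
    rw [hτ]
    ring

theorem mainTheorem4 (C c δ p : ℝ) (hC : 0 < C) (hc : 0 < c) (hδ : 0 < δ) (hp : p < 1) :
    ∃ (C' c' : ℝ) (K : ℝ → ℝ), 0 < C' ∧ 0 < c' ∧
      ∀ (n : ℕ) (Ω : Type*) [MeasurableSpace Ω] (P : Measure Ω) [IsProbabilityMeasure P]
        (X : Fin n → Ω → ℝ),
        (∀ i, Measurable (X i)) →
        iIndepFun X P →
        (∀ i j, IdentDistrib (X i) (X j) P P) →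
        (∀ i, ∀ t : ℝ, 0 < t → P.real {ω | t ≤ |X i ω|} ≤ C * Real.exp (-c * t ^ 2)) →
        (∀ i, ∫ ω, X i ω ∂P = 0) →
        (∀ i, levyConcentration P (X i) δ ≤ p) →
        ∀ (α β : EuclideanSpace ℝ (Fin n)) (γ : ℝ), α ≠ 0 → 0 < γ →
          P.real {ω | |linearForm α X ω| ≤ |linearForm β X ω|} ≤
              C' * (‖β‖ / ‖α‖ * (1 + Real.sqrt (Real.posLog (‖α‖ / ‖β‖)))
                + 1 / essentialLCD γ (‖α‖⁻¹ • α) + Real.exp (-c' * γ ^ 2)) ∧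
          ∀ r : ℝ, 0 < r → r < 1 → ‖β‖ ≤ r * ‖α‖ →
            P.real {ω | |linearForm α X ω| ≤ |linearForm β X ω|} ≤
              K r * (‖β‖ / ‖α‖ * Real.sqrt (Real.log (‖α‖ / ‖β‖))
                + 1 / essentialLCD γ (‖α‖⁻¹ • α) + Real.exp (-c' * γ ^ 2)) := by
  set B := Real.sqrt (Real.pi / ((1 - p) / 100)) with hB
  set D := 4 * Real.pi / δ * Real.sqrt (2 * varianceProxy C c) with hD
  have hB0 : 0 ≤ B := Real.sqrt_nonneg _
  have hD0 : 0 ≤ D := by positivity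
  set C' := 4 + 4 * B + 4 * B * D with hC'
  have hBD : 0 ≤ B * D := mul_nonneg hB0 hD0
  have hC'0 : 0 < C' := by linarith
  -- When ‖β‖ ≤ r‖α‖ the logarithm is at least log(1/r), so the bare term ‖β‖/‖α‖ is absorbed into
  -- the logarithmic one at the cost of 1/√log(1/r).
  refine ⟨C', 1 - p, fun r => C' * (1 + 1 / Real.sqrt (Real.log (1 / r))), hC'0, by linarith, ?_⟩
  intro n Ω _ P _ X hX hind hid htail hmean hconc α β γ hα hγ
  have hα0 : 0 < ‖α‖ := norm_pos_iff.2 hα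
  have hlcd : 0 ≤ 1 / essentialLCD γ (‖α‖⁻¹ • α) := by
    have hunit : ‖‖α‖⁻¹ • α‖ = 1 := by
      rw [norm_smul, norm_inv, norm_norm, inv_mul_cancel₀ hα0.ne']
    exact (one_div_pos.2 (essentialLCD_pos hunit hγ)).le
  set E := Real.exp (-(1 - p) * γ ^ 2) with hE
  have hE0 : 0 < E := Real.exp_pos _
  set l := 1 / essentialLCD γ (‖α‖⁻¹ • α) with hl
  set ε := ‖β‖ / ‖α‖ with hε
  have hε0 : 0 ≤ ε := by positivity
  have hfirst : ‖β‖ < ‖α‖ → P.real {ω | |linearForm α X ω| ≤ |linearForm β X ω|} ≤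
      C' * (ε * (1 + Real.sqrt (Real.log (‖α‖ / ‖β‖))) + l + E) := by
    intro hβ
    refine (measureReal_abs_linearForm_le_abs_linearForm hC hc hδ hp hX hind hid htail hmean hconc
      hα hγ hβ).trans ?_
    set y := ε * Real.sqrt (Real.log (‖α‖ / ‖β‖)) with hy
    have hy0 : 0 ≤ y := by positivity
    rw [mul_add ε, mul_one, ← hy, hC', ← mul_assoc (4 * Real.pi / δ)]
    change 4 * (E + B * (D * y + l)) + 2 * ε ≤ _
    nlinarith [mul_nonneg hB0 hlcd, mul_nonneg hB0 hE0.le, mul_nonneg hB0 hε0, mul_nonneg hB0 hy0,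
      mul_nonneg hBD hlcd, mul_nonneg hBD hE0.le, mul_nonneg hBD hε0, mul_nonneg hBD hy0]
  refine ⟨?_, fun r hr0 hr1 hβr => ?_⟩
  · rcases lt_or_ge ‖β‖ ‖α‖ with hβ | hβ
    · refine (hfirst hβ).trans ?_
      gcongr
      exact le_max_right _ _
    -- Here the bound is trivial: the right side already exceeds 1, since C' ≥ 4.
    · have h1 : 1 ≤ ε := (one_le_div hα0).2 hβ
      refine (measureReal_le_one (μ := P)).trans ?_
      have h2 : 1 ≤ ε * (1 + Real.sqrt (Real.posLog (‖α‖ / ‖β‖))) + l + E := by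
        have := mul_nonneg hε0 (Real.sqrt_nonneg (Real.posLog (‖α‖ / ‖β‖)))
        linarith
      nlinarith
  · have hβ : ‖β‖ < ‖α‖ := by nlinarith
    refine (hfirst hβ).trans ?_
    rw [mul_assoc]
    refine mul_le_mul_of_nonneg_left ?_ hC'0.le
    have hlogr : 0 < Real.log (1 / r) := Real.log_pos ((one_lt_div hr0).2 hr1)
    set ρ := Real.sqrt (Real.log (1 / r)) with hρ
    have hρ0 : 0 < ρ := Real.sqrt_pos.2 hlogr
    have hερ : ε ≤ 1 / ρ * (ε * Real.sqrt (Real.log (‖α‖ / ‖β‖))) := by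
      -- For β = 0 the factor ε vanishes, so the term has its limit value 0 whatever default the
      -- logarithm takes.
      rcases eq_or_ne β 0 with rfl | hβ0
      · simp [hε]
      · have hβpos : 0 < ‖β‖ := norm_pos_iff.2 hβ0
        have : ρ ≤ Real.sqrt (Real.log (‖α‖ / ‖β‖)) := by
          refine Real.sqrt_le_sqrt (Real.log_le_log (by positivity) ?_)
          rw [div_le_div_iff₀ hr0 hβpos]
          linarith
        calc ε = 1 / ρ * (ε * ρ) := by field_simp
          _ ≤ _ := by gcongr
    have h1 : 0 ≤ 1 / ρ * (l + E) := by positivity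
    nlinarith
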